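/- A stochastic cooperative game on the player set $N=\{1,\dots,n\}$ is a family $(\mathbb P_S)_{S\subseteq N}$ of probability distributions on $[0,1]$; write $\mu(S)=\mathbb E_{r\sim\mathbb P_S}[r]$. The game is convex if $\mu(S\cup\{i\})-\mu(S)\ge\mu(C\cup\{i\})-\mu(C)$ for all $C\subseteq S\subseteq N$ and $i\notin S\cup C$, and it is Bernoulli if every $\mathbb P_S$ is supported on $\{0,1\}$. Its expected core is $\{x\in\mathbb R^n : \sum_{i\in N}x_i=\mu(N),\ \sum_{i\in S}x_i\ge\mu(S)\ \forall S\subseteq N\}$, and its dimension is the dimension of its affine hull. A bandit algorithm is given $\mu(N)$; in each round, based on the coalitions it has queried and the rewards it has observed so far, and possibly on internal randomness, it either queries a coalition $S$ and observes a reward drawn from $\mathbb P_S$ independently of the past, or stops and outputs a point of $\mathbb R^n$. Theorem. Let $0\le k<n-1$ and $0<\delta<0.2$. No bandit algorithm can, using finitely many samples, output a point of the expected core with probability at least $1-\delta$ on every game whose expected core has dimension $k$, even if the games are restricted to convex Bernoulli games. That is, for every bandit algorithm there is a convex Bernoulli game on $N$ whose expected core is nonempty and has dimension exactly $k$, such that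 the probability that the algorithm, run on this game, stops after finitely many queries and outputs a point of the expected core is strictly less than $1-\delta$. -/

import Mathlib

open MeasureTheory ProbabilityTheory
open scoped ENNReal unitInterval

noncomputable section

namespace CoreLearning

/-- A stochastic cooperative game on the player set `Fin n`: a family of reward distributions on
`[0,1]`, one for each coalition `S ⊆ Fin n`. -/
structure StochasticGame (n : ℕ) where
  /-- the reward distribution of each coalition -/
  reward : Finset (Fin n) → ProbabilityMeasure I

namespace StochasticGame

variable {n : ℕ}

/-- The expected reward `μ(S)` of the coalition `S`. -/
def mean (G : StochasticGame n) (S : Finset (Fin n)) : ℝ :=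
  ∫ r, (r : ℝ) ∂(G.reward S : Measure I)

/-- All rewards are Bernoulli, i.e. supported on `{0, 1}`. -/
def IsBernoulli (G : StochasticGame n) : Prop :=
  ∀ S, (G.reward S : Measure I) {0, 1} = 1

/-- The game is convex: the expected reward function is supermodular. -/
def IsConvex (G : StochasticGame n) : Prop :=
  ∀ C S : Finset (Fin n), C ⊆ S → ∀ i, i ∉ S ∪ C →
    G.mean (insert i C) - G.mean C ≤ G.mean (insert i S) - G.mean S

/-- The expected core: allocations `x` with `x(N) = μ(N)` and `x(S) ≥ μ(S)` for all `S ⊆ N`. -/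
def core (G : StochasticGame n) : Set (Fin n → ℝ) :=
  {x | ∑ i, x i = G.mean Finset.univ ∧ ∀ S : Finset (Fin n), G.mean S ≤ ∑ i ∈ S, x i}

/-- The expected core is a (nonempty) convex set of dimension `k`, i.e. its affine hull has
dimension `k`. -/
def CoreHasDim (G : StochasticGame n) (k : ℕ) : Prop :=
  G.core.Nonempty ∧ Module.finrank ℝ (vectorSpan ℝ G.core) = k

end StochasticGame

/-- The bandit histories of length `t`: the coalitions queried in the first `t` rounds, each with
the reward that was observed. -/
abbrev History (n t : ℕ) : Type := Fin t → Finset (Fin n) × I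

/-- A (possibly randomised, adaptive) bandit algorithm with a stopping rule. After having seen a
history of length `t` it either queries a further coalition `S` (the outcome `Sum.inl S`) or stops
and outputs an allocation `x` (the outcome `Sum.inr x`); the choice is random, with a law that
depends measurably on the history. The algorithm has no other access to the game. -/
structure BanditAlgorithm (n : ℕ) where
  /-- the law of the decision taken after a history of length `t` -/
  step : ∀ t : ℕ, Kernel (History n t) (Finset (Fin n) ⊕ (Fin n → ℝ))
  isMarkov : ∀ t, IsMarkovKernel (step t)

namespace BanditAlgorithm

variable {n : ℕ}

/-- The sub-probability law of the history of length `t`: `A.historyLaw G t E` is the probability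
that `A`, run on the game `G`, makes at least `t` queries and that the history of the first `t`
queries lies in `E`. Given the history and the next queried coalition `S`, the reward is drawn from
`G.reward S`, independently of the past. -/
def historyLaw (A : BanditAlgorithm n) (G : StochasticGame n) : ∀ t : ℕ, Measure (History n t)
  | 0 => Measure.dirac Fin.elim0
  | t + 1 => ∑ S : Finset (Fin n),
      (((A.historyLaw G t).withDensity (fun h => A.step t h {Sum.inl S})).prod
        (G.reward S : Measure I)).map
          (fun p => (Fin.snoc p.1 (S, p.2) : History n (t + 1)))

/-- The probability that `A`, run on the game `G`, stops after finitely many queries and outputs an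
allocation in the set `B`: the sum over `t` of the probabilities that it makes exactly `t` queries
and then outputs a point of `B`. -/
def outputProb (A : BanditAlgorithm n) (G : StochasticGame n) (B : Set (Fin n → ℝ)) : ℝ≥0∞ :=
  ∑' t : ℕ, ∫⁻ h, A.step t h (Sum.inr '' B) ∂(A.historyLaw G t)

end BanditAlgorithm

end CoreLearning

end

namespace CoreLearning

/-! ### Change of measure along histories. -/

namespace BanditAlgorithm

variable {n : ℕ} (A : BanditAlgorithm n) (G : StochasticGame n)

/-! Two-point argument. The games `blockGame n k a` all have grand-coalition mean 1, so knowing it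
does not tell them apart. Every core point pays player k + 1 exactly `a`, so cores for different `a`
are disjoint, and for a < 1 each is a k-dimensional simplex. Suppose the algorithm succeeds with
probability above 4/5 on every such game. At a = 1/2, some finite horizon T already captures more
than 4/5. Only then choose r < 1 with r ^ T ≥ 3/4 and perturb `a` so that every reward law loses at
most a factor r (`smul_blockGame_reward_le`). T queries lose at most r ^ T
(`pow_mul_sum_le_outputProb`), so on the perturbed game the old core is still hit with probability
at least 3/5 and its own core with more than 4/5. These are disjoint events of total mass above 1.
-/

lemma measurable_snoc_history (t : ℕ) (S : Finset (Fin n)) :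
    Measurable (fun p : History n t × I => (Fin.snoc p.1 (S, p.2) : History n (t + 1))) := by
  refine measurable_pi_iff.2 fun i => ?_
  refine Fin.lastCases ?_ (fun j => ?_) i
  · simp only [Fin.snoc_last]
    fun_prop
  · simp only [Fin.snoc_castSucc]
    fun_prop

/-- If the rewards of `G` are dominated by those of `G'` up to a factor, then so are the laws of
the histories. -/
lemma smul_historyLaw_le {G G' : StochasticGame n} {r : ℝ≥0∞}
    (h : ∀ S, r • (G.reward S : Measure I) ≤ G'.reward S) (t : ℕ) :
    r ^ t • A.historyLaw G t ≤ A.historyLaw G' t := by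
  induction t with
  | zero => simp [historyLaw]
  | succ t ih =>
    simp only [historyLaw, Finset.smul_sum]
    refine Finset.sum_le_sum fun S _ => ?_
    -- The decision kernel is the same for both games: the factor r ^ t goes to the past and the
    -- remaining r to the new reward.
    rw [← Measure.map_smul, pow_succ, mul_smul, ← Measure.prod_smul_right, ← Measure.prod_smul_left,
      ← withDensity_smul_measure]
    refine Measure.map_mono (Measure.prod_mono ?_ (h S)) (measurable_snoc_history t S)
    refine Measure.le_iff.2 fun s hs => ?_
    rw [withDensity_apply _ hs, withDensity_apply _ hs]
    exact lintegral_mono' (Measure.restrict_mono le_rfl ih) le_rfl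

lemma measurableSet_query (S : Finset (Fin n)) :
    MeasurableSet ({Sum.inl S} : Set (Finset (Fin n) ⊕ (Fin n → ℝ))) := by
  simpa using (measurableSet_singleton S).inl_image (β := Fin n → ℝ)

lemma historyLaw_succ_univ (t : ℕ) :
    A.historyLaw G (t + 1) Set.univ
      = ∫⁻ h, ∑ S, A.step t h {Sum.inl S} ∂(A.historyLaw G t) := by
  rw [lintegral_finsetSum _ fun S _ => (A.step t).measurable_coe (measurableSet_query S)]
  simp only [historyLaw, Measure.finsetSum_apply]
  refine Finset.sum_congr rfl fun S _ => ?_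
  rw [Measure.map_apply (measurable_snoc_history t S) MeasurableSet.univ, Set.preimage_univ,
    ← Set.univ_prod_univ, Measure.prod_prod, withDensity_apply _ MeasurableSet.univ]
  simp

/-- A run either makes one more query or stops. -/
lemma historyLaw_succ_univ_add (t : ℕ) :
    A.historyLaw G (t + 1) Set.univ
        + ∫⁻ h, A.step t h (Sum.inr '' Set.univ) ∂(A.historyLaw G t)
      = A.historyLaw G t Set.univ := by
  rw [historyLaw_succ_univ, ← lintegral_add_left
    (Finset.measurable_fun_sum _ fun S _ => (A.step t).measurable_coe (measurableSet_query S)),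
    ← setLIntegral_univ, ← setLIntegral_one]
  refine lintegral_congr fun h => ?_
  have := A.isMarkov t
  rw [← measure_univ (μ := A.step t h), ← measure_biUnion_finset, ← measure_union]
  · congr 1
    ext (S | x) <;> simp
  · rw [Set.disjoint_left]
    rintro (S | x) <;> simp
  · exact MeasurableSet.univ.inr_image
  · intro S _ S' _ hne
    simpa [Function.onFun] using hne
  · exact fun S _ => measurableSet_query S

lemma outputProb_univ_le_one : A.outputProb G Set.univ ≤ 1 := by
  -- Conservation of mass: the runs still active after T queries and those stopped earlier have
  -- total probability 1.
  have key : ∀ T, A.historyLaw G T Set.univ + ∑ t ∈ Finset.range T,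
      ∫⁻ h, A.step t h (Sum.inr '' Set.univ) ∂(A.historyLaw G t) = 1 := fun T => by
    induction T with
    | zero => simp [historyLaw]
    | succ T ih =>
      rw [Finset.sum_range_succ, ← ih, ← A.historyLaw_succ_univ_add G T]
      ring
  exact ENNReal.tsum_le_of_sum_range_le fun T => (key T) ▸ le_add_self

/-- The output cannot lie in two disjoint sets. -/
lemma outputProb_add_le_one {B C : Set (Fin n → ℝ)} (hB : MeasurableSet B) (hC : MeasurableSet C)
    (hBC : Disjoint B C) : A.outputProb G B + A.outputProb G C ≤ 1 := by
  refine le_trans (le_of_eq_of_le ENNReal.tsum_add.symm ?_) (A.outputProb_univ_le_one G)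
  refine ENNReal.tsum_le_tsum fun t => ?_
  rw [← lintegral_add_left ((A.step t).measurable_coe hB.inr_image)]
  refine lintegral_mono fun h => ?_
  rw [← measure_union ((Set.disjoint_image_iff Sum.inr_injective).2 hBC) hC.inr_image]
  refine measure_mono ?_
  rw [← Set.image_union]
  exact Set.image_mono (Set.subset_univ _)

/-- Changing the rewards by a factor close to `1` barely changes the probability of stopping within
`T` rounds with an output in `B`. -/
lemma pow_mul_sum_le_outputProb {G G' : StochasticGame n} {r : ℝ≥0∞} (hr : r ≤ 1)
    (h : ∀ S, r • (G.reward S : Measure I) ≤ G'.reward S) (T : ℕ) (B : Set (Fin n → ℝ)) :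
    r ^ T * ∑ t ∈ Finset.range T, ∫⁻ h, A.step t h (Sum.inr '' B) ∂(A.historyLaw G t)
      ≤ A.outputProb G' B := by
  refine le_trans ?_ (ENNReal.sum_le_tsum (Finset.range T))
  rw [Finset.mul_sum]
  refine Finset.sum_le_sum fun t ht => ?_
  calc r ^ T * ∫⁻ h, A.step t h (Sum.inr '' B) ∂(A.historyLaw G t)
      ≤ r ^ t * ∫⁻ h, A.step t h (Sum.inr '' B) ∂(A.historyLaw G t) := by
        gcongr ?_ * _
        exact pow_le_pow_right_of_le_one' hr (Finset.mem_range.1 ht).le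
    _ = ∫⁻ h, A.step t h (Sum.inr '' B) ∂(r ^ t • A.historyLaw G t) := by
        rw [lintegral_smul_measure, smul_eq_mul]
    _ ≤ _ := lintegral_mono' (A.smul_historyLaw_le h t) le_rfl

end BanditAlgorithm

/-! ### Bernoulli rewards and the family of block games. -/

/-- The Bernoulli distribution with parameter `p`, as a distribution on the unit interval. -/
noncomputable def bernoulliUnit (p : I) : ProbabilityMeasure I :=
  ⟨ENNReal.ofReal p • Measure.dirac 1 + ENNReal.ofReal (1 - p) • Measure.dirac 0, ⟨by
    simp [← ENNReal.ofReal_add p.2.1 (sub_nonneg.2 p.2.2)]⟩⟩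

lemma coe_bernoulliUnit (p : I) : (bernoulliUnit p : Measure I)
    = ENNReal.ofReal p • Measure.dirac 1 + ENNReal.ofReal (1 - p) • Measure.dirac 0 := rfl

lemma integral_bernoulliUnit (p : I) : ∫ r, (r : ℝ) ∂(bernoulliUnit p : Measure I) = p := by
  rw [coe_bernoulliUnit, integral_add_measure, integral_smul_measure, integral_smul_measure]
  · simp [ENNReal.toReal_ofReal p.2.1]
  · exact (integrable_dirac (by simp)).smul_measure ENNReal.ofReal_ne_top
  · exact (integrable_dirac (by simp)).smul_measure ENNReal.ofReal_ne_top

lemma bernoulliUnit_zero_one (p : I) : (bernoulliUnit p : Measure I) {0, 1} = 1 := by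
  simp [coe_bernoulliUnit, ← ENNReal.ofReal_add p.2.1 (sub_nonneg.2 p.2.2)]

lemma smul_bernoulliUnit_le {r : ℝ} {p q : I} (hr : 0 ≤ r) (h₁ : r * p ≤ q)
    (h₀ : r * (1 - p) ≤ 1 - q) :
    ENNReal.ofReal r • (bernoulliUnit p : Measure I) ≤ bernoulliUnit q := by
  rw [coe_bernoulliUnit, coe_bernoulliUnit, smul_add, smul_smul, smul_smul,
    ← ENNReal.ofReal_mul hr, ← ENNReal.ofReal_mul hr]
  refine Measure.le_iff.2 fun s _ => ?_
  simp only [Measure.add_apply, Measure.smul_apply, smul_eq_mul]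
  gcongr

open Classical in
/-- The characteristic function that gives `1 - a` to the coalitions containing the block of the
first `k + 1` players and, additively, `a` to the coalitions containing the player `k + 1`. -/
noncomputable def blockValue (n k : ℕ) (a : I) (S : Finset (Fin n)) : I :=
  ⟨(if ∀ i : Fin n, i.val ≤ k → i ∈ S then 1 - (a : ℝ) else 0)
      + if ∀ i : Fin n, i.val = k + 1 → i ∈ S then (a : ℝ) else 0, by
    have := a.2.1
    have := a.2.2
    constructor <;> split_ifs <;> linarith⟩

/-- The Bernoulli game with expected rewards `blockValue n k a`. -/
noncomputable def blockGame (n k : ℕ) (a : I) : StochasticGame n :=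
  ⟨fun S => bernoulliUnit (blockValue n k a S)⟩

section blockGame

variable {n k : ℕ} {a : I}

open Classical in
lemma blockGame_mean (S : Finset (Fin n)) : (blockGame n k a).mean S =
    (if ∀ i : Fin n, i.val ≤ k → i ∈ S then 1 - (a : ℝ) else 0)
      + if ∀ i : Fin n, i.val = k + 1 → i ∈ S then (a : ℝ) else 0 :=
  integral_bernoulliUnit _

lemma blockGame_mean_univ : (blockGame n k a).mean Finset.univ = 1 := by
  simp [blockGame_mean]

lemma blockGame_isBernoulli : (blockGame n k a).IsBernoulli :=
  fun _ => bernoulliUnit_zero_one _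

/-- Unanimity functions are supermodular. -/
lemma unanimity_supermodular {ι : Type*} [DecidableEq ι] (P : ι → Prop) {b : ℝ} (hb : 0 ≤ b)
    {C S : Finset ι} (hCS : C ⊆ S) {i : ι} (hi : i ∉ S) [∀ T : Finset ι, Decidable (∀ j, P j → j ∈ T)] :
    (if ∀ j, P j → j ∈ insert i C then b else 0) - (if ∀ j, P j → j ∈ C then b else 0)
      ≤ (if ∀ j, P j → j ∈ insert i S then b else 0) - (if ∀ j, P j → j ∈ S then b else 0) := by
  have h₁ : (∀ j, P j → j ∈ C) → ∀ j, P j → j ∈ S := fun h j hj => hCS (h j hj)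
  have h₂ : (∀ j, P j → j ∈ insert i C) → ∀ j, P j → j ∈ insert i S :=
    fun h j hj => Finset.insert_subset_insert i hCS (h j hj)
  have h₃ : (∀ j, P j → j ∈ S) → ∀ j, P j → j ∈ insert i S :=
    fun h j hj => Finset.mem_insert_of_mem (h j hj)
  have h₄ : (∀ j, P j → j ∈ insert i C) → (∀ j, P j → j ∈ S) → ∀ j, P j → j ∈ C :=
    fun h h' j hj => (Finset.mem_insert.1 (h j hj)).resolve_left fun e => hi (e ▸ h' j hj)
  split_ifs <;> first | linarith | tauto

lemma blockGame_isConvex : (blockGame n k a).IsConvex := by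
  classical
  intro C S hCS i hi
  have hiS : i ∉ S := fun h => hi (Finset.mem_union_left _ h)
  have h₁ := unanimity_supermodular (fun j : Fin n => j.val ≤ k) (sub_nonneg.2 a.2.2) hCS hiS
  have h₂ := unanimity_supermodular (fun j : Fin n => j.val = k + 1) a.2.1 hCS hiS
  simp only [blockGame_mean]
  linarith

lemma core_apply_nonneg {x : Fin n → ℝ} (hx : x ∈ (blockGame n k a).core) (i : Fin n) :
    0 ≤ x i := by
  have h := hx.2 {i}
  rw [Finset.sum_singleton] at h
  exact (blockValue n k a {i}).2.1.trans ((blockGame_mean {i}).symm.le.trans h)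

/-- Every core allocation gives the player `k + 1` exactly `a`, the block `1 - a`, and all others
nothing. -/
lemma mem_core_blockGame_iff (hk : k + 1 < n) {x : Fin n → ℝ} :
    x ∈ (blockGame n k a).core ↔ (∀ i, 0 ≤ x i) ∧ x ⟨k + 1, hk⟩ = a ∧
      (∑ i with i.val ≤ k, x i) = 1 - a ∧ ∀ i : Fin n, k + 1 < i.val → x i = 0 := by
  have hsplit : ∑ i, x i = (∑ i with i.val ≤ k, x i) + x ⟨k + 1, hk⟩
      + ∑ i with k + 1 < i.val, x i := by
    rw [← Finset.sum_filter_add_sum_filter_not Finset.univ (fun i : Fin n => i.val ≤ k), add_assoc]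
    congr 1
    rw [← Finset.sum_insert (by simp)]
    refine Finset.sum_congr ?_ fun _ _ => rfl
    ext i
    simp [Fin.ext_iff]
    omega
  constructor
  · intro hx
    have hnn := core_apply_nonneg hx
    have h₁ := hx.1
    rw [blockGame_mean_univ, hsplit] at h₁
    have h₂ : 1 - (a : ℝ) ≤ ∑ i with i.val ≤ k, x i := by
      refine le_trans ?_ (hx.2 _)
      rw [blockGame_mean, if_pos (by simp), if_neg]
      · simp
      · simpa using ⟨⟨k + 1, hk⟩, by simp⟩
    have h₃ : (a : ℝ) ≤ x ⟨k + 1, hk⟩ := by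
      have h := hx.2 {⟨k + 1, hk⟩}
      rw [Finset.sum_singleton] at h
      refine le_trans ?_ h
      rw [blockGame_mean, if_neg, if_pos]
      · simp
      · simp [Fin.ext_iff]
      · intro h
        simpa [Fin.ext_iff] using h ⟨0, by omega⟩ (Nat.zero_le k)
    -- The three lower bounds 1 - a, a and 0 already add up to the total 1, so all are tight.
    have h₄ : 0 ≤ ∑ i with k + 1 < i.val, x i := Finset.sum_nonneg fun i _ => hnn i
    refine ⟨hnn, by linarith, by linarith, fun i hi => ?_⟩
    refine (Finset.sum_eq_zero_iff_of_nonneg fun i _ => hnn i).1 (?_ : ∑ i with k + 1 < i.val, x i = 0)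
      i (by simpa using hi)
    linarith
  · rintro ⟨hnn, ha, hb, h0⟩
    refine ⟨?_, fun S => ?_⟩
    · rw [blockGame_mean_univ, hsplit, ha, hb, Finset.sum_eq_zero fun i hi => h0 i (by simpa using hi)]
      ring
    · rw [blockGame_mean, ← Finset.sum_filter_add_sum_filter_not S (fun i : Fin n => i.val ≤ k)]
      refine add_le_add ?_ ?_
      · split_ifs with h
        · rw [← hb]
          refine Finset.sum_le_sum_of_subset_of_nonneg (fun i hi => ?_) fun i _ _ => hnn i
          have hi' : i.val ≤ k := by simpa using hi
          simpa using ⟨h i hi', hi'⟩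
        · exact Finset.sum_nonneg fun i _ => hnn i
      · split_ifs with h
        · rw [← ha]
          exact Finset.single_le_sum (f := x) (fun i _ => hnn i) (by simpa using h _ rfl)
        · exact Finset.sum_nonneg fun i _ => hnn i

/-- The vertices of the core of `blockGame n k a`. -/
noncomputable def blockVertex (hk : k + 1 < n) (a : I) (j : Fin (k + 1)) : Fin n → ℝ :=
  Pi.single ⟨k + 1, hk⟩ (a : ℝ) + Pi.single (j.castLE hk.le) (1 - (a : ℝ))

lemma blockVertex_apply_block (hk : k + 1 < n) (j l : Fin (k + 1)) :
    blockVertex hk a j (l.castLE hk.le) = if j = l then 1 - (a : ℝ) else 0 := by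
  have h : (l.castLE hk.le) ≠ ⟨k + 1, hk⟩ := fun h => by
    have := l.2
    have := congrArg Fin.val h
    simp at this
    omega
  simp [blockVertex, Pi.single_apply, h, Fin.ext_iff, eq_comm]

/-- On the block coordinates the vertices are 1 - a times the unit vectors; at a = 1 they would all
coincide. -/
lemma affineIndependent_blockVertex (hk : k + 1 < n) (ha : (a : ℝ) < 1) :
    AffineIndependent ℝ (blockVertex hk a) := by
  refine affineIndependent_iff.2 fun s w _ h l hl => ?_
  have := congrFun h (l.castLE hk.le)
  simp only [Finset.sum_apply, Pi.smul_apply, blockVertex_apply_block, smul_eq_mul, mul_ite,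
    mul_zero, Finset.sum_ite_eq', hl, if_true, Pi.zero_apply] at this
  exact (mul_eq_zero.1 this).resolve_right (sub_pos.2 ha).ne'

lemma sum_block (hk : k + 1 < n) (f : Fin n → ℝ) :
    ∑ i with i.val ≤ k, f i = ∑ j : Fin (k + 1), f (j.castLE hk.le) := by
  refine Eq.trans ?_ (Finset.sum_map Finset.univ (Fin.castLEEmb hk.le) f)
  refine Finset.sum_congr ?_ fun _ _ => rfl
  ext i
  simp only [Finset.mem_filter, Finset.mem_univ, true_and, Finset.mem_map]
  constructor
  · exact fun h => ⟨⟨i, by omega⟩, rfl⟩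
  · rintro ⟨j, rfl⟩
    exact Nat.lt_succ_iff.1 j.2

lemma blockVertex_mem_core (hk : k + 1 < n) (j : Fin (k + 1)) :
    blockVertex hk a j ∈ (blockGame n k a).core := by
  have ha := a.2.1
  have hb := sub_nonneg.2 a.2.2
  have hj := j.2
  refine (mem_core_blockGame_iff hk).2 ⟨fun i => ?_, ?_, ?_, fun i hi => ?_⟩
  · simp only [blockVertex, Pi.add_apply, Pi.single_apply]
    split_ifs <;> linarith
  · have : k + 1 ≠ j.val := by omega
    simp [blockVertex, Fin.ext_iff, this]
  · simp [sum_block hk, blockVertex_apply_block]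
  · have h₁ : i.val ≠ k + 1 := by omega
    have h₂ : i.val ≠ j.val := by omega
    simp [blockVertex, Fin.ext_iff, h₁, h₂]

lemma core_subset_affineSpan (hk : k + 1 < n) (ha : (a : ℝ) < 1) :
    (blockGame n k a).core ⊆ affineSpan ℝ (Set.range (blockVertex hk a)) := by
  intro x hx
  obtain ⟨-, hxa, hxb, hx0⟩ := (mem_core_blockGame_iff hk).1 hx
  have hb := (sub_pos.2 ha).ne'
  rw [sum_block hk] at hxb
  -- The block receives 1 - a in total, so these weights sum to 1.
  set w : Fin (k + 1) → ℝ := fun j => x (j.castLE hk.le) / (1 - a) with hw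
  have hw1 : ∑ j, w j = 1 := by rw [hw, ← Finset.sum_div, hxb, div_self hb]
  have hx' : x = Finset.univ.affineCombination ℝ (blockVertex hk a) w := by
    rw [Finset.affineCombination_eq_linear_combination _ _ _ hw1]
    ext i
    rcases lt_trichotomy i.val (k + 1) with hi | hi | hi
    · obtain ⟨l, rfl⟩ : ∃ l : Fin (k + 1), l.castLE hk.le = i := ⟨⟨i, hi⟩, rfl⟩
      simp [blockVertex_apply_block, hw, hb]
    · obtain rfl : i = ⟨k + 1, hk⟩ := Fin.ext hi
      have h (j : Fin (k + 1)) : blockVertex hk a j ⟨k + 1, hk⟩ = a :=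
        ((mem_core_blockGame_iff hk).1 (blockVertex_mem_core hk j)).2.1
      simp [h, ← Finset.sum_mul, hw1, hxa]
    · have h (j : Fin (k + 1)) : blockVertex hk a j i = 0 :=
        ((mem_core_blockGame_iff hk).1 (blockVertex_mem_core hk j)).2.2.2 i hi
      simp [h, hx0 i hi]
  rw [hx']
  exact affineCombination_mem_affineSpan hw1 _

lemma blockGame_coreHasDim (hk : k + 1 < n) (ha : (a : ℝ) < 1) :
    (blockGame n k a).CoreHasDim k := by
  refine ⟨⟨_, blockVertex_mem_core hk 0⟩, ?_⟩
  have : affineSpan ℝ (blockGame n k a).core = affineSpan ℝ (Set.range (blockVertex hk a)) :=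
    le_antisymm (affineSpan_le.2 (core_subset_affineSpan hk ha))
      (affineSpan_mono ℝ (Set.range_subset_iff.2 (blockVertex_mem_core hk)))
  rw [← direction_affineSpan, this, direction_affineSpan]
  exact (affineIndependent_blockVertex hk ha).finrank_vectorSpan (Fintype.card_fin _)

lemma disjoint_core_blockGame (hk : k + 1 < n) {b : I} (hab : a ≠ b) :
    Disjoint (blockGame n k a).core (blockGame n k b).core :=
  Set.disjoint_left.2 fun _ hx hy => hab <| Subtype.ext <|
    ((mem_core_blockGame_iff hk).1 hx).2.1.symm.trans ((mem_core_blockGame_iff hk).1 hy).2.1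

lemma StochasticGame.measurableSet_core (G : StochasticGame n) : MeasurableSet G.core := by
  refine MeasurableSet.inter (measurableSet_eq_fun (by fun_prop) measurable_const) ?_
  refine (MeasurableSet.iInter fun S => measurableSet_le (measurable_const (a := G.mean S))
    (Finset.measurable_fun_sum S fun i _ => measurable_pi_apply i)).congr ?_
  ext x
  exact Set.mem_iInter

/-- The games with parameters `1 / 2` and `1 - r / 2` are close if `r` is close to `1`. -/
lemma smul_blockGame_reward_le {b : I} {r : ℝ} (hr₀ : 0 ≤ r) (hr₁ : r ≤ 1) (ha : (a : ℝ) = 1 / 2)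
    (hb : (b : ℝ) = 1 - r / 2) (S : Finset (Fin n)) :
    ENNReal.ofReal r • ((blockGame n k a).reward S : Measure I) ≤ (blockGame n k b).reward S := by
  -- Means 0 and 1 are unchanged; 1/2 becomes r/2 or 1 - r/2, where one of the two atoms shrinks by
  -- exactly r.
  refine smul_bernoulliUnit_le hr₀ ?_ ?_ <;> simp only [blockValue, ha, hb] <;> split_ifs <;>
    linarith

end blockGame

end CoreLearning

/-! ### The two-point contradiction. -/

theorem theorem1 (n k : ℕ) (hk : k + 1 < n) (δ : ℝ) (hδ₀ : 0 < δ) (hδ₁ : δ < 1 / 5)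
    (A : ℝ → CoreLearning.BanditAlgorithm n) :
    ∃ G : CoreLearning.StochasticGame n,
      G.IsBernoulli ∧ G.IsConvex ∧ G.CoreHasDim k ∧
        (A (G.mean Finset.univ)).outputProb G G.core < ENNReal.ofReal (1 - δ) := by
  by_contra! hA
  have hsucc (a : unitInterval) (ha : (a : ℝ) < 1) :
      ENNReal.ofReal (4 / 5) <
      (A 1).outputProb (CoreLearning.blockGame n k a) (CoreLearning.blockGame n k a).core := by
    have h := hA (CoreLearning.blockGame n k a) CoreLearning.blockGame_isBernoulli
      CoreLearning.blockGame_isConvex (CoreLearning.blockGame_coreHasDim hk ha)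
    rw [CoreLearning.blockGame_mean_univ] at h
    exact ((ENNReal.ofReal_lt_ofReal_iff (by linarith)).2 (by linarith)).trans_le h
  let a : unitInterval := ⟨1 / 2, by norm_num, by norm_num⟩
  have h₀ := hsucc a (by norm_num [a])
  rw [CoreLearning.BanditAlgorithm.outputProb, ENNReal.tsum_eq_iSup_nat, lt_iSup_iff] at h₀
  obtain ⟨T, hT⟩ := h₀
  obtain ⟨r, hr₀, hr₁, hrT⟩ : ∃ r : ℝ, 0 < r ∧ r < 1 ∧ 3 / 4 ≤ r ^ T := by
    have hT' : (0 : ℝ) < T + 1 := by positivity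
    have hq : 1 / (4 * (T + 1 : ℝ)) ≤ 1 / 4 := by
      gcongr
      linarith
    have hq' : T * (1 / (4 * (T + 1 : ℝ))) ≤ 1 / 4 := by
      field_simp
      linarith
    have hpos : 0 < 1 / (4 * (T + 1 : ℝ)) := by positivity
    -- Bernoulli's inequality gives r ^ T ≥ 1 - T / (4(T + 1)) ≥ 3/4; T + 1 in place of T covers T =
    -- 0.
    refine ⟨1 + -(1 / (4 * (T + 1))), by linarith, by linarith, ?_⟩
    refine le_trans ?_ (one_add_mul_le_pow (by linarith) T)
    linarith
  let b : unitInterval := ⟨1 - r / 2, by linarith, by linarith⟩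
  have hab : a ≠ b := fun h => by
    have : (1 / 2 : ℝ) = 1 - r / 2 := congrArg Subtype.val h
    linarith
  have h₁ := hsucc b (by simp only [b]; linarith)
  have h₂ := (A 1).pow_mul_sum_le_outputProb (ENNReal.ofReal_le_one.2 hr₁.le)
    (CoreLearning.smul_blockGame_reward_le (n := n) (k := k) (a := a) (b := b)
      hr₀.le hr₁.le rfl rfl) T (CoreLearning.blockGame n k a).core
  have h₃ : ENNReal.ofReal (3 / 5) ≤
      (A 1).outputProb (CoreLearning.blockGame n k b) (CoreLearning.blockGame n k a).core := by
    refine le_trans ?_ h₂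
    calc ENNReal.ofReal (3 / 5) = ENNReal.ofReal (3 / 4) * ENNReal.ofReal (4 / 5) := by
          rw [← ENNReal.ofReal_mul (by norm_num)]
          norm_num
      _ ≤ _ := by
          rw [← ENNReal.ofReal_pow hr₀.le]
          exact mul_le_mul' (ENNReal.ofReal_le_ofReal hrT) hT.le
  have h₄ := (A 1).outputProb_add_le_one (CoreLearning.blockGame n k b)
    (CoreLearning.blockGame n k a).measurableSet_core (CoreLearning.blockGame n k b).measurableSet_core
    (CoreLearning.disjoint_core_blockGame hk hab)
  have h₅ := (add_le_add h₃ h₁.le).trans h₄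
  rw [← ENNReal.ofReal_add (by norm_num) (by norm_num), ENNReal.ofReal_le_one] at h₅
  norm_num at h₅
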